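/- Let $m\ge 1$ be an integer, $p\in(1,\infty)$, and let $E\subset\mathbb{R}$ be closed. Let $L^m_p(\mathbb{R})$ be the space of all functions $F:\mathbb{R}\to\mathbb{R}$ whose derivative $F^{(m-1)}$ exists and is absolutely continuous on $\mathbb{R}$ and whose weak $m$-th derivative $F^{(m)}$ belongs to $L_p(\mathbb{R})$, with the seminorm $\|F\|_{L^m_p(\mathbb{R})}=\|F^{(m)}\|_{L_p(\mathbb{R})}$. For a $C^{m-1}$-function $F$ and $x\in\mathbb{R}$ let $T^{m-1}_x[F](y)=\sum_{k=0}^{m-1}\frac{1}{k!}F^{(k)}(x)(y-x)^k$ be its Taylor polynomial at $x$. Let $\mathbf{P}=\{P_x\}_{x\in E}$ be a Whitney $(m-1)$-field on $E$, that is, a family of real polynomials of degree at most $m-1$ indexed by the points of $E$. Then there exists a $C^{m-1}$-function $F\in L^m_p(\mathbb{R})$ such that $T^{m-1}_x[F]=P_x$ for every $x\in E$ if and only if the quantity $$ \mathcal{N}_{m,p,E}(\mathbf{P})=\sup\left\{\sum_{j=1}^{k-1}\sum_{i=0}^{m-1}\frac{\bigl|P^{(i)}_{x_j}(x_j)-P^{(i)}_{x_{j+1}}(x_j)\bigr|^p}{(x_{j+1}-x_j)^{(m-i)p-1}}\right\}^{1/p}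 $$ is finite, where the supremum is taken over all integers $k>1$ and all strictly increasing sequences $x_1<\dots<x_k$ of points of $E$ (and is $0$ if $E$ has at most one point). Furthermore, put $$ \|\mathbf{P}\|_{m,p,E}=\inf\left\{\|F\|_{L^m_p(\mathbb{R})}: F\in L^m_p(\mathbb{R}),\ T^{m-1}_x[F]=P_x \text{ for every } x\in E\right\}, $$ with $\inf\emptyset=+\infty$. There is a constant $C=C(m)\ge 1$ depending only on $m$ such that $$ C^{-1}\,\mathcal{N}_{m,p,E}(\mathbf{P})\le\|\mathbf{P}\|_{m,p,E}\le C\,\mathcal{N}_{m,p,E}(\mathbf{P}). $$ -/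

import Mathlib

open MeasureTheory Polynomial
open scoped ENNReal NNReal ContDiff

noncomputable section

/-- `g` is a weak derivative of order `m` of `F` on the real line. -/
def IsWeakDeriv (m : ℕ) (F g : ℝ → ℝ) : Prop :=
  LocallyIntegrable F ∧ LocallyIntegrable g ∧
    ∀ φ : ℝ → ℝ, ContDiff ℝ ∞ φ → HasCompactSupport φ →
      ∫ x, F x * iteratedDeriv m φ x = (-1) ^ m * ∫ x, g x * φ x

/-- Absolute continuity on `ℝ`, i.e. on every compact interval. (If the derivative lies in `L_p`
with `p > 1`, this is equivalent to the uniform `ε`-`δ` condition on the whole line.) -/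
def IsAbsolutelyContinuous (G : ℝ → ℝ) : Prop :=
  ∀ a b : ℝ, AbsolutelyContinuousOnInterval G a b

/-- Membership in the homogeneous Sobolev space `L^m_p(ℝ)`, for `m ≥ 1`: the derivative of order
`m - 1` exists and is absolutely continuous (so that `F` is of class `C^{m-1}`), and the weak
derivative of order `m` lies in `L_p(ℝ)`. -/
structure MemHomSobolev (m : ℕ) (p : ℝ) (F : ℝ → ℝ) : Prop where
  contDiff : ContDiff ℝ (m - 1 : ℕ) F
  absolutelyContinuous : IsAbsolutelyContinuous (iteratedDeriv (m - 1) F)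
  exists_weakDeriv : ∃ g : ℝ → ℝ, IsWeakDeriv m F g ∧ MemLp g (ENNReal.ofReal p)

/-- The seminorm `‖F^{(m)}‖_{L_p(ℝ)}`, where `F^{(m)}` is the weak derivative. All weak derivatives
of order `m` of `F` agree almost everywhere, so the infimum is over equal numbers; see
`homSobolevSeminorm_eq`. -/
def homSobolevSeminorm (m : ℕ) (p : ℝ) (F : ℝ → ℝ) : ℝ≥0∞ :=
  ⨅ (g : ℝ → ℝ) (_ : IsWeakDeriv m F g), eLpNorm g (ENNReal.ofReal p)

theorem IsWeakDeriv.ae_eq {m : ℕ} {F g h : ℝ → ℝ} (hg : IsWeakDeriv m F g)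
    (hh : IsWeakDeriv m F h) : g =ᵐ[volume] h := by
  refine ae_eq_of_integral_contDiff_smul_eq hg.2.1 hh.2.1 fun φ hφ hc => ?_
  have h1 := (hg.2.2 φ hφ hc).symm.trans (hh.2.2 φ hφ hc)
  have h2 := mul_left_cancel₀ (pow_ne_zero m (by norm_num : (-1 : ℝ) ≠ 0)) h1
  simpa [smul_eq_mul, mul_comm] using h2

theorem homSobolevSeminorm_eq {m : ℕ} {p : ℝ} {F g : ℝ → ℝ} (hg : IsWeakDeriv m F g) :
    homSobolevSeminorm m p F = eLpNorm g (ENNReal.ofReal p) :=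
  le_antisymm (iInf₂_le g hg)
    (le_iInf₂ fun _ hh => (eLpNorm_congr_ae (hg.ae_eq hh)).le)

/-- The Taylor polynomial `T^n_x[F]` of degree `n` of `F` at `x`. -/
def taylorPoly (n : ℕ) (F : ℝ → ℝ) (x : ℝ) : ℝ[X] :=
  ∑ k ∈ Finset.range (n + 1), C (iteratedDeriv k F x / (k.factorial : ℝ)) * (X - C x) ^ k

/-- A Whitney `n`-field on `E`: a family, indexed by `E`, of polynomials of degree at most `n`. -/
def IsWhitneyField (n : ℕ) {E : Set ℝ} (P : E → ℝ[X]) : Prop :=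
  ∀ x : E, (P x).natDegree ≤ n

/-- The `L^m_p`-norm of a Whitney `(m-1)`-field `P` on `E`: the infimum of the seminorms of the
functions in `L^m_p(ℝ)` which agree with `P` on `E` (infinite if there are none). -/
def jetNorm (m : ℕ) (p : ℝ) {E : Set ℝ} (P : E → ℝ[X]) : ℝ≥0∞ :=
  ⨅ (F : ℝ → ℝ) (_ : MemHomSobolev m p F ∧ ∀ x : E, taylorPoly (m - 1) F x = P x),
    homSobolevSeminorm m p F

/-- The sum attached to a sequence `x 0 < x 1 < ... < x (n + 1)` in `E`. -/
def jetVariationSum (m : ℕ) (p : ℝ) {E : Set ℝ} (P : E → ℝ[X]) {n : ℕ} (x : Fin (n + 2) → E) : ℝ :=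
  ∑ j : Fin (n + 1), ∑ i ∈ Finset.range m,
    |(derivative^[i] (P (x j.castSucc))).eval (x j.castSucc : ℝ)
        - (derivative^[i] (P (x j.succ))).eval (x j.castSucc : ℝ)| ^ p
      / ((x j.succ : ℝ) - (x j.castSucc : ℝ)) ^ (((m : ℝ) - (i : ℝ)) * p - 1)

/-- The variational quantity of a Whitney `(m-1)`-field: the supremum over all finite strictly
increasing sequences of at least two points of `E`, to the power `1 / p`. It is `0` if `E` has at
most one point. -/
def jetVariation (m : ℕ) (p : ℝ) {E : Set ℝ} (P : E → ℝ[X]) : ℝ≥0∞ :=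
  (⨆ (n : ℕ) (x : Fin (n + 2) → E) (_ : StrictMono x),
    ENNReal.ofReal (jetVariationSum m p P x)) ^ (1 / p)

end

/-! Write `m = n + 1`. For an extension `F`, expand at the right end of a gap and evaluate at the
left end. The Taylor remainder of `F^{(i)}` is at most the gap length to the power `n - i` times the
integral of `|F^{(m)}|` over the gap. Hölder turns its `p`-th power into the weight in the variation
times the integral of `|F^{(m)}|^p` over the gap (`rpow_abs_iteratedDeriv_sub_taylorPoly_le`). Gaps
are disjoint, so summing gives the lower bound for the norm.

Conversely, on a finite subset of `E` the polynomials at consecutive points are joined by a rescaled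
smooth cutoff. The `m`-th derivative of the result lives in the gaps and is controlled there by the
jumps of the field (`exists_integral_iteratedDeriv_gluedPoly_le`), so the seminorms are bounded
uniformly over all finite subsets (`exists_extension_finset`).

A compactness argument then reaches all of `E` (`exists_extension_of_forall_finset`). Along an
ultrafilter of finite subsets, the derivatives of order at most `n` converge pointwise. The limits
inherit the Taylor remainder bounds, hence are successive derivatives of one function. The top one
inherits a bound on its Riesz `p`-variation, and Riesz's theorem makes it absolutely continuous with
derivative in `L_p`, without loss in the constant.

Constants independent of `p` result from bounding `p`-th powers by `B ^ p` and from `(n + 1) ^ (1 /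
p) ≤ n + 1`. -/

/-! ### Absolute continuity and weak derivatives. -/

theorem IsAbsolutelyContinuous.continuous {G : ℝ → ℝ} (hG : IsAbsolutelyContinuous G) :
    Continuous G := by
  refine continuous_iff_continuousAt.2 fun x => ?_
  refine (hG (x - 1) (x + 1)).continuousOn.continuousAt ?_
  rw [Set.uIcc_of_le (by linarith)]
  exact Icc_mem_nhds (by linarith) (by linarith)

theorem IsAbsolutelyContinuous.locallyIntegrable_deriv {G : ℝ → ℝ}
    (hG : IsAbsolutelyContinuous G) : LocallyIntegrable (deriv G) := by
  rw [locallyIntegrable_iff]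
  intro K hK
  obtain ⟨R, hR⟩ := hK.isBounded.subset_closedBall 0
  rcases le_or_gt R 0 with h | h
  · have := (hG (-1) 1).intervalIntegrable_deriv
    rw [intervalIntegrable_iff_integrableOn_Icc_of_le (by norm_num)] at this
    refine this.mono_set (hR.trans ?_)
    rw [Real.closedBall_eq_Icc]
    exact Set.Icc_subset_Icc (by linarith) (by linarith)
  · have := (hG (-R) R).intervalIntegrable_deriv
    rw [intervalIntegrable_iff_integrableOn_Icc_of_le (by linarith)] at this
    refine this.mono_set (hR.trans ?_)
    rw [Real.closedBall_eq_Icc, zero_sub, zero_add]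

theorem IsAbsolutelyContinuous.ae_differentiableAt {G : ℝ → ℝ}
    (hG : IsAbsolutelyContinuous G) : ∀ᵐ x, DifferentiableAt ℝ G x := by
  have h : ∀ N : ℕ, ∀ᵐ x, x ∈ Set.uIcc (-(N : ℝ)) N → DifferentiableAt ℝ G x := fun N =>
    (hG (-(N : ℝ)) N).ae_differentiableAt
  filter_upwards [ae_all_iff.2 h] with x hx
  obtain ⟨N, hN⟩ := exists_nat_ge |x|
  refine hx N ?_
  rw [Set.uIcc_of_le (by linarith [abs_nonneg x])]
  exact abs_le.1 hN

theorem IsAbsolutelyContinuous.integral_mul_deriv {G φ : ℝ → ℝ} (hG : IsAbsolutelyContinuous G)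
    (hφ : ContDiff ℝ ∞ φ) (hc : HasCompactSupport φ) :
    ∫ x, G x * deriv φ x = -∫ x, deriv G x * φ x := by
  obtain ⟨R₀, hR₀⟩ := hc.isCompact.isBounded.subset_closedBall 0
  -- The extra `1` puts the support inside the open interval, so the boundary terms vanish.
  set R := max R₀ 0 + 1
  have hR : 0 < R := by positivity
  have hsub : tsupport φ ⊆ Set.Ioo (-R) R := by
    refine hR₀.trans ?_
    rw [Real.closedBall_eq_Icc]
    intro x hx
    have := le_max_left R₀ 0
    constructor <;> simp only [R] <;> linarith [hx.1, hx.2]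
  have hzero : ∀ x, x ∉ Set.Ioo (-R) R → φ x = 0 := fun x hx =>
    image_eq_zero_of_notMem_tsupport fun h => hx (hsub h)
  have hzero' : ∀ x, x ∉ Set.Ioo (-R) R → deriv φ x = 0 := fun x hx =>
    image_eq_zero_of_notMem_tsupport fun h => hx (hsub (tsupport_deriv_subset h))
  have key : ∀ f : ℝ → ℝ, (∀ x, x ∉ Set.Ioo (-R) R → f x = 0) →
      ∫ x, f x = ∫ x in (-R)..R, f x := by
    intro f hf
    rw [intervalIntegral.integral_of_le (by linarith)]
    refine (setIntegral_eq_integral_of_forall_compl_eq_zero fun x hx => hf x ?_).symm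
    exact fun h => hx (Set.Ioo_subset_Ioc_self h)
  rw [key _ fun x hx => by rw [hzero' x hx, mul_zero], key _ fun x hx => by rw [hzero x hx, mul_zero],
    AbsolutelyContinuousOnInterval.integral_mul_deriv_eq_deriv_mul (hG _ _)
      ((hφ.of_le (by exact_mod_cast le_top)).contDiffOn.absolutelyContinuousOnInterval),
    hzero R (by simp), hzero (-R) (by simp)]
  ring

/-- Derivatives are moved from `φ` to `F` one at a time. All but the last move are classical
integrations by parts; the last, which is the base case, uses absolute continuity. -/
theorem isWeakDeriv_of_isAbsolutelyContinuous {n : ℕ} {F : ℝ → ℝ} (hF : ContDiff ℝ n F)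
    (hG : IsAbsolutelyContinuous (iteratedDeriv n F)) :
    IsWeakDeriv (n + 1) F (deriv (iteratedDeriv n F)) := by
  refine ⟨hF.continuous.locallyIntegrable, hG.locallyIntegrable_deriv, fun φ hφ hc => ?_⟩
  induction n generalizing F with
  | zero =>
    simp only [iteratedDeriv_zero, zero_add, pow_one, iteratedDeriv_one] at hG ⊢
    rw [hG.integral_mul_deriv hφ hc]; ring
  | succ n ih =>
    have hF' : ContDiff ℝ n (deriv F) := by
      have := (contDiff_succ_iff_deriv (n := (n : WithTop ℕ∞))).1 (by exact_mod_cast hF)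
      exact this.2.2
    have hdF : Differentiable ℝ F := hF.differentiable (by simp)
    have hφn : ∀ k, ContDiff ℝ ∞ (iteratedDeriv k φ) := fun k => by
      refine contDiff_infty.2 fun j => ?_
      rw [iteratedDeriv_eq_iterate]
      exact ContDiff.iterate_deriv' j k (hφ.of_le (by exact_mod_cast le_top))
    have hcn : ∀ k, HasCompactSupport (iteratedDeriv k φ) := fun k => by
      induction k with
      | zero => simpa using hc
      | succ k ihk => rw [iteratedDeriv_succ]; exact ihk.deriv
    have h := ih hF' (by rwa [← iteratedDeriv_succ'])
    rw [iteratedDeriv_succ' (f := F), pow_succ, mul_assoc, mul_comm (-1 : ℝ), ← mul_assoc, ← h]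
    have hcd := (hφn (n + 1)).continuous
    have hcd' := (hφn (n + 1 + 1)).continuous
    have := integral_mul_deriv_eq_deriv_mul_of_integrable (u := F) (u' := deriv F)
      (v := iteratedDeriv (n + 1) φ) (v' := iteratedDeriv (n + 1 + 1) φ)
      (fun x _ => (hdF x).hasDerivAt)
      (fun x _ => by
        rw [iteratedDeriv_succ (n := n + 1)]
        exact (((hφn (n + 1)).differentiable (by simp)) x).hasDerivAt)
      ((hF.continuous.mul hcd').integrable_of_hasCompactSupport (hcn _).mul_left)
      ((hF'.continuous.mul hcd).integrable_of_hasCompactSupport (hcn _).mul_left)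
      ((hF.continuous.mul hcd).integrable_of_hasCompactSupport (hcn _).mul_left)
    rw [this]; ring

/-! ### Taylor expansions of polynomials and Taylor polynomials. -/

theorem eval_iterate_derivative_eq_factorial_mul (P : ℝ[X]) (k : ℕ) (y : ℝ) :
    (derivative^[k] P).eval y = k.factorial * (taylor y P).coeff k := by
  rw [taylor_coeff, ← factorial_smul_hasseDeriv]
  simp [nsmul_eq_mul]

theorem eval_eq_sum_iterate_derivative {P : ℝ[X]} {n : ℕ} (hP : P.natDegree ≤ n) (x y : ℝ) :
    P.eval x =
      ∑ l ∈ Finset.range (n + 1), (derivative^[l] P).eval y * (x - y) ^ l / l.factorial := by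
  rw [← taylor_eval_sub y, eval_eq_sum_range' (n := n + 1) (by rw [natDegree_taylor]; omega)]
  refine Finset.sum_congr rfl fun l _ => ?_
  rw [eval_iterate_derivative_eq_factorial_mul]
  have : (l.factorial : ℝ) ≠ 0 := by positivity
  field_simp

theorem eval_iterate_derivative_eq_sum {P : ℝ[X]} {n i : ℕ} (hP : P.natDegree ≤ n) (hi : i ≤ n)
    (x y : ℝ) :
    (derivative^[i] P).eval x = ∑ l ∈ Finset.range (n + 1 - i),
      (derivative^[i + l] P).eval y * (x - y) ^ l / l.factorial := by
  rw [eval_eq_sum_iterate_derivative (P := derivative^[i] P) (n := n - i)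
    ((natDegree_iterate_derivative P i).trans (by omega)) x y, show n - i + 1 = n + 1 - i by omega]
  refine Finset.sum_congr rfl fun l _ => ?_
  rw [← Function.iterate_add_apply, add_comm]

theorem natDegree_taylorPoly_le (n : ℕ) (F : ℝ → ℝ) (y : ℝ) :
    (taylorPoly n F y).natDegree ≤ n := by
  refine natDegree_sum_le_of_forall_le _ _ fun k hk => ?_
  refine (natDegree_C_mul_le _ _).trans ?_
  simpa [natDegree_pow, Nat.lt_succ_iff] using hk

theorem eval_iterate_derivative_taylorPoly {n k : ℕ} (hk : k ≤ n) (F : ℝ → ℝ) (y : ℝ) :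
    (derivative^[k] (taylorPoly n F y)).eval y = iteratedDeriv k F y := by
  have : taylor y (taylorPoly n F y) =
      ∑ k ∈ Finset.range (n + 1), C (iteratedDeriv k F y / (k.factorial : ℝ)) * X ^ k := by
    rw [taylorPoly, map_sum]
    refine Finset.sum_congr rfl fun k _ => ?_
    simp [taylor_mul, taylor_pow, taylor_X, taylor_C]
  rw [eval_iterate_derivative_eq_factorial_mul, this, finsetSum_coeff]
  have h0 : (k.factorial : ℝ) ≠ 0 := by positivity
  simp only [coeff_C_mul, coeff_X_pow, mul_ite, mul_one, mul_zero]
  rw [Finset.sum_ite_eq, if_pos (by simpa [Nat.lt_succ_iff] using hk)]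
  field_simp

/-- A polynomial of degree at most `n` is the Taylor polynomial of any function with the same
derivatives. -/
theorem taylorPoly_eq_of_forall {n : ℕ} {P : ℝ[X]} (hP : P.natDegree ≤ n) {F : ℝ → ℝ} {y : ℝ}
    (h : ∀ k ≤ n, iteratedDeriv k F y = (derivative^[k] P).eval y) : taylorPoly n F y = P := by
  refine funext fun x => ?_
  rw [eval_eq_sum_iterate_derivative hP x y,
    eval_eq_sum_iterate_derivative (natDegree_taylorPoly_le n F y) x y]
  refine Finset.sum_congr rfl fun k hk => ?_
  have hk : k ≤ n := by simpa [Nat.lt_succ_iff] using hk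
  rw [eval_iterate_derivative_taylorPoly hk, h k hk]

theorem iteratedDeriv_polynomial_eval (P : ℝ[X]) (k : ℕ) :
    iteratedDeriv k (fun x => P.eval x) = fun x => (derivative^[k] P).eval x := by
  induction k with
  | zero => simp
  | succ k ih =>
    rw [iteratedDeriv_succ, ih, Function.iterate_succ_apply']
    ext x
    exact Polynomial.deriv _

theorem ContDiff.hasDerivAt_iteratedDeriv {n i : ℕ} {F : ℝ → ℝ} (hF : ContDiff ℝ n F)
    (hi : i < n) (x : ℝ) : HasDerivAt (iteratedDeriv i F) (iteratedDeriv (i + 1) F x) x := by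
  rw [iteratedDeriv_succ]
  exact (hF.differentiable_iteratedDeriv i (by exact_mod_cast hi) x).hasDerivAt

/-! ### Taylor remainders in `L_p` and the lower bound for the norm. -/

/-- The Taylor remainder of order `n` is controlled by the oscillation of the derivative of
order `n`. -/
theorem abs_iteratedDeriv_sub_taylorPoly_le {n : ℕ} {F : ℝ → ℝ} (hF : ContDiff ℝ n F) {x y M : ℝ}
    (hM : ∀ t ∈ Set.uIcc x y, |iteratedDeriv n F t - iteratedDeriv n F y| ≤ M) {i : ℕ}
    (hi : i ≤ n) : ∀ t ∈ Set.uIcc x y,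
      |iteratedDeriv i F t - (derivative^[i] (taylorPoly n F y)).eval t| ≤
        M * |x - y| ^ (n - i) := by
  have hM0 : 0 ≤ M := (abs_nonneg _).trans (hM y Set.right_mem_uIcc)
  -- Induction on the distance `d` from the top order: the remainder vanishes at `y`, so the mean
  -- value inequality costs one factor `|x - y|` per order.
  obtain ⟨d, rfl⟩ : ∃ d, n = i + d := ⟨n - i, by omega⟩
  rw [Nat.add_sub_cancel_left]
  induction d generalizing i with
  | zero =>
    intro t ht
    rw [Nat.add_zero] at *
    rw [eval_iterate_derivative_eq_sum (natDegree_taylorPoly_le i F y) le_rfl t y]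
    simpa [eval_iterate_derivative_taylorPoly le_rfl] using hM t ht
  | succ d ih =>
    intro t ht
    have e : i + (d + 1) = (i + 1) + d := by ring
    have ih' := ih (i := i + 1) (by rwa [← e]) (by rwa [← e]) (by omega)
    rw [← e] at ih'
    have hy : iteratedDeriv i F y - (derivative^[i] (taylorPoly (i + (d + 1)) F y)).eval y = 0 := by
      rw [eval_iterate_derivative_taylorPoly (by omega), sub_self]
    have := Convex.norm_image_sub_le_of_norm_hasDerivWithin_le
      (f := fun t => iteratedDeriv i F t - (derivative^[i] (taylorPoly (i + (d + 1)) F y)).eval t)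
      (f' := fun t => iteratedDeriv (i + 1) F t -
        (derivative^[i + 1] (taylorPoly (i + (d + 1)) F y)).eval t)
      (s := Set.uIcc x y) (C := M * |x - y| ^ d) (x := y) (y := t)
      (fun u _ => ((hF.hasDerivAt_iteratedDeriv (by omega) u).sub (by
        rw [Function.iterate_succ_apply']
        exact Polynomial.hasDerivAt _ _)).hasDerivWithinAt)
      (fun u hu => ih' u hu) (convex_uIcc x y) Set.right_mem_uIcc ht
    simp only [hy, sub_zero, Real.norm_eq_abs] at this
    refine this.trans ?_
    rw [pow_succ, ← mul_assoc]
    refine mul_le_mul_of_nonneg_left ?_ (by positivity)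
    rw [Set.uIcc_comm] at ht
    exact Set.abs_sub_left_of_mem_uIcc ht

/-- Hölder's inequality against the constant `1`, raised to the power `p`. -/
theorem rpow_integral_abs_le {g : ℝ → ℝ} {p : ℝ} (hp : 1 < p) (hg : MemLp g (ENNReal.ofReal p))
    (a b : ℝ) :
    (∫ t in Set.uIoc a b, |g t|) ^ p ≤ |b - a| ^ (p - 1) * ∫ t in Set.uIoc a b, |g t| ^ p := by
  have hp0 : 0 < p := by linarith
  have hvol : volume.real (Set.uIoc a b) = |b - a| := by
    simp [measureReal_def, Real.volume_uIoc]
  have : IsFiniteMeasure (volume.restrict (Set.uIoc a b)) :=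
    ⟨by simp [Real.volume_uIoc]⟩
  have hq : p.HolderConjugate (p / (p - 1)) := Real.HolderConjugate.conjExponent hp
  have h1 := integral_mul_le_Lp_mul_Lq_of_nonneg (μ := volume.restrict (Set.uIoc a b)) hq
    (f := fun t => |g t|) (g := fun _ => 1) (Filter.Eventually.of_forall fun _ => abs_nonneg _)
    (Filter.Eventually.of_forall fun _ => zero_le_one) (hg.restrict _).abs (memLp_const _)
  simp only [mul_one, Real.one_rpow, integral_const, smul_eq_mul, measureReal_restrict_apply_univ,
    hvol] at h1
  have hI : 0 ≤ ∫ t in Set.uIoc a b, |g t| ^ p := by positivity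
  have h2 := Real.rpow_le_rpow (by positivity) h1 hp0.le
  rw [Real.mul_rpow (by positivity) (by positivity), ← Real.rpow_mul hI, ← Real.rpow_mul (abs_nonneg _),
    one_div_mul_cancel hp0.ne', Real.rpow_one, mul_comm] at h2
  convert h2 using 3
  have : p - 1 ≠ 0 := by linarith
  field_simp

theorem MeasureTheory.MemLp.integrable_abs_rpow {g : ℝ → ℝ} {p : ℝ} (hp : 1 < p)
    (hg : MemLp g (ENNReal.ofReal p)) : Integrable fun t => |g t| ^ p := by
  have := hg.integrable_norm_rpow (by simp; linarith) (by simp)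
  rwa [ENNReal.toReal_ofReal (by linarith)] at this

theorem abs_sub_le_integral_abs_deriv {G : ℝ → ℝ} (hG : IsAbsolutelyContinuous G) (x y : ℝ) :
    ∀ t ∈ Set.uIcc x y, |G t - G y| ≤ ∫ u in Set.uIoc x y, |deriv G u| := by
  intro t ht
  rw [← (hG y t).integral_deriv_eq_sub, ← Real.norm_eq_abs]
  refine (intervalIntegral.norm_integral_le_integral_norm_uIoc).trans ?_
  refine setIntegral_mono_set ?_ (Filter.Eventually.of_forall fun _ => abs_nonneg _)
    (LE.le.eventuallyLE ?_)
  · exact (intervalIntegrable_iff.1 (hG x y).intervalIntegrable_deriv).abs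
  · rw [Set.uIoc_comm x y]
    rw [Set.uIcc_comm] at ht
    exact Set.uIoc_subset_uIoc_of_uIcc_subset_uIcc (Set.uIcc_subset_uIcc_left ht)

/-- The `L_p` estimate of the Taylor remainder. -/
theorem rpow_abs_iteratedDeriv_sub_taylorPoly_le {n : ℕ} {F : ℝ → ℝ} {p : ℝ} (hp : 1 < p)
    (hF : ContDiff ℝ n F) (hG : IsAbsolutelyContinuous (iteratedDeriv n F))
    (hg : MemLp (deriv (iteratedDeriv n F)) (ENNReal.ofReal p)) {i : ℕ} (hi : i ≤ n) (x y : ℝ) :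
    |iteratedDeriv i F x - (derivative^[i] (taylorPoly n F y)).eval x| ^ p ≤
      |x - y| ^ ((((n + 1 : ℕ) : ℝ) - i) * p - 1) *
        ∫ t in Set.uIoc x y, |deriv (iteratedDeriv n F) t| ^ p := by
  have hp0 : 0 < p := by linarith
  have hI : 0 ≤ ∫ t in Set.uIoc x y, |deriv (iteratedDeriv n F) t| ^ p := by positivity
  rcases eq_or_ne x y with rfl | hxy
  · rw [eval_iterate_derivative_taylorPoly hi, sub_self, abs_zero, Real.zero_rpow hp0.ne']
    positivity
  have hpos : 0 < |x - y| := abs_pos.2 (sub_ne_zero.2 hxy)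
  have h := abs_iteratedDeriv_sub_taylorPoly_le hF (abs_sub_le_integral_abs_deriv hG x y) hi x
    Set.left_mem_uIcc
  refine (Real.rpow_le_rpow (abs_nonneg _) h hp0.le).trans ?_
  rw [Real.mul_rpow (by positivity) (by positivity)]
  have h2 := rpow_integral_abs_le hp hg x y
  rw [abs_sub_comm y x] at h2
  refine (mul_le_mul_of_nonneg_right h2 (by positivity)).trans_eq ?_
  -- Hölder contributes the exponent `p - 1` and the remainder bound `(n - i) * p`; they add up to
  -- `(n + 1 - i) * p - 1`.
  rw [mul_right_comm, ← Real.rpow_natCast, ← Real.rpow_mul hpos.le, ← Real.rpow_add hpos]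
  congr 2
  push_cast [hi]
  ring

theorem sum_integral_uIoc_le {ι : Type*} {f : ℝ → ℝ} (hf : Integrable f) (hf0 : ∀ t, 0 ≤ f t)
    (s : Finset ι) (a b : ι → ℝ)
    (hd : (s : Set ι).PairwiseDisjoint fun i => Set.uIoc (a i) (b i)) :
    ∑ i ∈ s, ∫ t in Set.uIoc (a i) (b i), f t ≤ ∫ t, f t := by
  rw [← integral_biUnion_finset s (fun i _ => measurableSet_uIoc) hd fun i _ => hf.integrableOn]
  exact setIntegral_le_integral hf (Filter.Eventually.of_forall hf0)

/-- The easy half of Riesz's theorem, applied later to the finite-set extensions. -/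
theorem sum_rpow_abs_sub_div_le {ι : Type*} {G : ℝ → ℝ} {p : ℝ} (hp : 1 < p)
    (hG : IsAbsolutelyContinuous G) (hg : MemLp (deriv G) (ENNReal.ofReal p))
    (s : Finset ι) (a b : ι → ℝ)
    (hd : (s : Set ι).PairwiseDisjoint fun i => Set.uIoc (a i) (b i)) :
    ∑ i ∈ s, |G (b i) - G (a i)| ^ p / |b i - a i| ^ (p - 1) ≤ ∫ t, |deriv G t| ^ p := by
  refine le_trans (Finset.sum_le_sum fun i _ => ?_)
    (sum_integral_uIoc_le (hg.integrable_abs_rpow hp) (fun _ => by positivity) s a b hd)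
  refine div_le_of_le_mul₀ (by positivity) (by positivity) ?_
  rw [mul_comm]
  refine le_trans ?_ (rpow_integral_abs_le hp hg _ _)
  refine Real.rpow_le_rpow (abs_nonneg _) ?_ (by linarith)
  rw [abs_sub_comm]
  exact abs_sub_le_integral_abs_deriv hG _ _ _ Set.left_mem_uIcc

theorem pairwiseDisjoint_uIoc_of_strictMono {n : ℕ} {x : Fin (n + 2) → ℝ} (hx : StrictMono x) :
    ((Finset.univ : Finset (Fin (n + 1))) : Set (Fin (n + 1))).PairwiseDisjoint
      fun j => Set.uIoc (x j.castSucc) (x j.succ) := by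
  have key : ∀ i j : Fin (n + 1), i < j →
      Disjoint (Set.uIoc (x i.castSucc) (x i.succ)) (Set.uIoc (x j.castSucc) (x j.succ)) := by
    intro i j hij
    rw [Set.uIoc_of_le (hx Fin.castSucc_lt_succ).le, Set.uIoc_of_le (hx Fin.castSucc_lt_succ).le]
    refine Set.Ioc_disjoint_Ioc_of_le (hx.monotone ?_)
    exact Fin.succ_le_castSucc_iff.2 hij
  intro i _ j _ hij
  rcases lt_or_gt_of_ne hij with h | h
  · exact key i j h
  · exact (key j i h).symm

theorem jetVariationSum_le {n : ℕ} {F : ℝ → ℝ} {p : ℝ} (hp : 1 < p)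
    (hF : ContDiff ℝ n F) (hG : IsAbsolutelyContinuous (iteratedDeriv n F))
    (hg : MemLp (deriv (iteratedDeriv n F)) (ENNReal.ofReal p)) {E : Set ℝ} {P : E → ℝ[X]}
    (hP : ∀ x : E, taylorPoly n F x = P x) {k : ℕ} {x : Fin (k + 2) → E} (hx : StrictMono x) :
    jetVariationSum (n + 1) p P x ≤ (n + 1) * ∫ t, |deriv (iteratedDeriv n F) t| ^ p := by
  have hx' : StrictMono fun j => (x j : ℝ) := fun i j h => hx h
  refine le_trans ?_ (mul_le_mul_of_nonneg_left (sum_integral_uIoc_le (hg.integrable_abs_rpow hp)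
    (fun _ => by positivity) _ _ _ (pairwiseDisjoint_uIoc_of_strictMono hx')) (by positivity))
  rw [Finset.mul_sum]
  refine Finset.sum_le_sum fun j _ => ?_
  have hlt : (x j.castSucc : ℝ) < x j.succ := hx' Fin.castSucc_lt_succ
  refine (Finset.sum_le_card_nsmul _ _
    (∫ t in Set.uIoc (x j.castSucc : ℝ) (x j.succ), |deriv (iteratedDeriv n F) t| ^ p)
    fun i hi => ?_).trans_eq (by simp)
  have hi : i ≤ n := by simpa [Nat.lt_succ_iff] using hi
  refine div_le_of_le_mul₀ (Real.rpow_nonneg (by linarith) _) (by positivity) ?_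
  -- The expansion is centred at the right endpoint and evaluated at the left one, as in the
  -- variation.
  have := rpow_abs_iteratedDeriv_sub_taylorPoly_le hp hF hG hg hi (x j.castSucc) (x j.succ)
  rw [abs_sub_comm (x j.castSucc : ℝ), abs_of_pos (sub_pos.2 hlt), mul_comm] at this
  rwa [← hP, ← hP, eval_iterate_derivative_taylorPoly hi]

/-! ### Smooth gluing of polynomials along a finite sequence of points. -/

theorem contDiff_polynomial_eval (R : ℝ[X]) {N : WithTop ℕ∞} : ContDiff ℝ N fun x => R.eval x := by
  have h : (fun x : ℝ => R.eval x) = fun x => aeval x R :=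
    _root_.funext fun x => (congrFun (coe_aeval_eq_eval x) R).symm
  rw [h]
  exact R.contDiff_aeval N

/-- A smooth function that is `0` on `(-∞, 1/3]` and `1` on `[2/3, ∞)`. -/
noncomputable def unitTransition (t : ℝ) : ℝ := Real.smoothTransition (3 * t - 1)

theorem contDiff_unitTransition : ContDiff ℝ ∞ unitTransition :=
  Real.smoothTransition.contDiff.comp ((contDiff_const.mul contDiff_id).sub contDiff_const)

theorem unitTransition_of_le {t : ℝ} (ht : t ≤ 1 / 3) : unitTransition t = 0 :=
  Real.smoothTransition.zero_of_nonpos (by linarith)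

theorem unitTransition_of_ge {t : ℝ} (ht : 2 / 3 ≤ t) : unitTransition t = 1 :=
  Real.smoothTransition.one_of_one_le (by linarith)

theorem exists_bound_iteratedDeriv_unitTransition (m : ℕ) :
    ∃ B : ℝ, 0 ≤ B ∧ ∀ k ≤ m, ∀ t ∈ Set.Icc (0 : ℝ) 1, |iteratedDeriv k unitTransition t| ≤ B := by
  have h : ∀ k, ∃ B : ℝ, ∀ t ∈ Set.Icc (0 : ℝ) 1, |iteratedDeriv k unitTransition t| ≤ B :=
    fun k => isCompact_Icc.exists_bound_of_continuousOn
      (contDiff_unitTransition.continuous_iteratedDeriv k (by exact_mod_cast le_top)).continuousOn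
  choose B hB using h
  have hB0 : ∀ k, 0 ≤ B k := fun k => (abs_nonneg _).trans (hB k 0 (by simp))
  refine ⟨∑ k ∈ Finset.range (m + 1), B k, Finset.sum_nonneg fun k _ => hB0 k, fun k hk t ht => ?_⟩
  exact (hB k t ht).trans (Finset.single_le_sum (fun k _ => hB0 k)
    (Finset.mem_range.2 (by omega)))

/-- The polynomial `R`, switched on smoothly between `a` and `b`. -/
noncomputable def switchedPoly (a b : ℝ) (R : ℝ[X]) (x : ℝ) : ℝ :=
  unitTransition ((x - a) / (b - a)) * R.eval x

theorem contDiff_comp_unitTransition (a b : ℝ) :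
    ContDiff ℝ ∞ fun x => unitTransition ((x - a) / (b - a)) :=
  contDiff_unitTransition.comp ((contDiff_id.sub contDiff_const).div_const _)

theorem contDiff_switchedPoly (a b : ℝ) (R : ℝ[X]) : ContDiff ℝ ∞ (switchedPoly a b R) :=
  (contDiff_comp_unitTransition a b).mul (contDiff_polynomial_eval R)

/-- The cutoff is constant on the outer thirds of the gap, so equality holds on a neighbourhood even
at the endpoint and all derivatives match there. -/
theorem switchedPoly_eventuallyEq_zero {a b x : ℝ} (hab : a < b) (hx : x ≤ a) (R : ℝ[X]) :
    switchedPoly a b R =ᶠ[nhds x] fun _ => 0 := by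
  have : ∀ᶠ y in nhds x, y < a + (b - a) / 3 := eventually_lt_nhds (by linarith)
  filter_upwards [this] with y hy
  rw [switchedPoly, unitTransition_of_le, zero_mul]
  rw [div_le_iff₀ (by linarith)]
  linarith

theorem switchedPoly_eventuallyEq_eval {a b x : ℝ} (hab : a < b) (hx : b ≤ x) (R : ℝ[X]) :
    switchedPoly a b R =ᶠ[nhds x] fun x => R.eval x := by
  have : ∀ᶠ y in nhds x, b - (b - a) / 3 < y := eventually_gt_nhds (by linarith)
  filter_upwards [this] with y hy
  rw [switchedPoly, unitTransition_of_ge, one_mul]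
  rw [le_div_iff₀ (by linarith)]
  linarith

theorem iteratedDeriv_switchedPoly_eq_zero {n : ℕ} {a b x : ℝ} (hab : a < b)
    (hx : x ∉ Set.Ioo a b) {R : ℝ[X]} (hR : R.natDegree ≤ n) :
    iteratedDeriv (n + 1) (switchedPoly a b R) x = 0 := by
  rcases le_or_gt x a with h | h
  · rw [(switchedPoly_eventuallyEq_zero hab h R).iteratedDeriv_eq]
    simp
  · have hb : b ≤ x := not_lt.1 fun hb => hx ⟨h, hb⟩
    rw [(switchedPoly_eventuallyEq_eval hab hb R).iteratedDeriv_eq, iteratedDeriv_polynomial_eval,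
      iterate_derivative_eq_zero (by omega)]
    simp

theorem iteratedDeriv_comp_unitTransition (a b : ℝ) (k : ℕ) (x : ℝ) :
    iteratedDeriv k (fun x => unitTransition ((x - a) / (b - a))) x =
      iteratedDeriv k unitTransition ((x - a) / (b - a)) / (b - a) ^ k := by
  have h1 : (fun x => unitTransition ((x - a) / (b - a))) =
      fun x => (fun y => unitTransition ((b - a)⁻¹ * y)) (x - a) := by
    ext x; simp only []; rw [div_eq_inv_mul]
  rw [h1, iteratedDeriv_comp_sub_const (f := fun y => unitTransition ((b - a)⁻¹ * y)),
    iteratedDeriv_comp_const_mul (contDiff_unitTransition.of_le (by exact_mod_cast le_top))]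
  simp only []
  rw [div_eq_inv_mul, div_eq_inv_mul, inv_pow]

/-- Expand at `a`, bound `x - a` by `b - a` and drop the factorials. The weights make each term
homogeneous in `b - a`, so no constant appears. -/
theorem abs_eval_iterate_derivative_div_le {n i : ℕ} (hi : i ≤ n) {R : ℝ[X]}
    (hR : R.natDegree ≤ n) {a b x : ℝ} (hab : a < b) (hx : x ∈ Set.Icc a b) :
    |(derivative^[i] R).eval x| / (b - a) ^ (n + 1 - i) ≤
      ∑ j ∈ Finset.range (n + 1), |(derivative^[j] R).eval a| / (b - a) ^ (n + 1 - j) := by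
  have hh : 0 < b - a := by linarith
  calc |(derivative^[i] R).eval x| / (b - a) ^ (n + 1 - i)
      ≤ (∑ l ∈ Finset.range (n + 1 - i), |(derivative^[i + l] R).eval a| * (b - a) ^ l)
          / (b - a) ^ (n + 1 - i) := by
        gcongr
        rw [eval_iterate_derivative_eq_sum hR hi x a]
        refine (Finset.abs_sum_le_sum_abs _ _).trans (Finset.sum_le_sum fun l _ => ?_)
        rw [abs_div, abs_mul, abs_pow, abs_of_nonneg (sub_nonneg.2 hx.1), Nat.abs_cast]
        have h1 : (1 : ℝ) ≤ l.factorial := by exact_mod_cast Nat.factorial_pos l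
        have hxa : 0 ≤ x - a := sub_nonneg.2 hx.1
        refine (div_le_self (by positivity) h1).trans ?_
        gcongr
        exact hx.2
    _ = ∑ j ∈ Finset.Ico i (n + 1), |(derivative^[j] R).eval a| / (b - a) ^ (n + 1 - j) := by
        rw [Finset.sum_div, Finset.sum_Ico_eq_sum_range]
        refine Finset.sum_congr rfl fun l hl => ?_
        have hl : l < n + 1 - i := by simpa using hl
        rw [show n + 1 - i = (n + 1 - (i + l)) + l by omega, pow_add]
        field_simp
    _ ≤ _ := by
        refine Finset.sum_le_sum_of_subset_of_nonneg ?_ fun _ _ _ => by positivity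
        intro j hj
        simp only [Finset.mem_Ico, Finset.mem_range] at hj ⊢
        exact hj.2

theorem exists_abs_iteratedDeriv_switchedPoly_le (n : ℕ) :
    ∃ B : ℝ, 0 ≤ B ∧ ∀ {a b x : ℝ} {R : ℝ[X]}, a < b → R.natDegree ≤ n → x ∈ Set.Icc a b →
      |iteratedDeriv (n + 1) (switchedPoly a b R) x| ≤
        B * ∑ j ∈ Finset.range (n + 1), |(derivative^[j] R).eval a| / (b - a) ^ (n + 1 - j) := by
  obtain ⟨B, hB0, hB⟩ := exists_bound_iteratedDeriv_unitTransition (n + 1)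
  refine ⟨∑ k ∈ Finset.range (n + 1 + 1), ((n + 1).choose k : ℝ) * B, by positivity, ?_⟩
  intro a b x R hab hR hx
  have hh : 0 < b - a := by linarith
  have h1 : iteratedDeriv (n + 1) (switchedPoly a b R) x = ∑ k ∈ Finset.range (n + 1 + 1),
      ((n + 1).choose k : ℝ) * iteratedDeriv k (fun x => unitTransition ((x - a) / (b - a))) x *
        iteratedDeriv (n + 1 - k) (fun x => R.eval x) x :=
    iteratedDeriv_fun_mul
      (((contDiff_comp_unitTransition a b).of_le (by exact_mod_cast le_top)).contDiffAt)
      (contDiff_polynomial_eval R).contDiffAt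
  rw [h1, Finset.sum_mul]
  refine (Finset.abs_sum_le_sum_abs _ _).trans (Finset.sum_le_sum fun k hk => ?_)
  have hk : k ≤ n + 1 := by simpa [Nat.lt_succ_iff] using hk
  rw [iteratedDeriv_polynomial_eval, iteratedDeriv_comp_unitTransition]
  -- In the Leibniz sum the undifferentiated cutoff meets a derivative of order `n + 1` of `R`,
  -- which is zero. For `k > 0` the factor `(b - a) ^ k` from rescaling is the weight belonging to
  -- order `n + 1 - k`.
  rcases Nat.eq_zero_or_pos k with rfl | hk0
  · rw [Nat.sub_zero, iterate_derivative_eq_zero (by omega)]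
    simp only [eval_zero, mul_zero, abs_zero]
    positivity
  · have h2 := abs_eval_iterate_derivative_div_le (i := n + 1 - k) (by omega) hR hab hx
    rw [show n + 1 - (n + 1 - k) = k by omega] at h2
    have h3 := hB k hk ((x - a) / (b - a))
      ⟨div_nonneg (by linarith [hx.1]) hh.le, (div_le_one hh).2 (by linarith [hx.2])⟩
    rw [abs_mul, abs_mul, Nat.abs_cast, abs_div, abs_pow, abs_of_pos hh, mul_assoc, mul_assoc]
    refine mul_le_mul_of_nonneg_left ?_ (by positivity)
    rw [div_mul_eq_mul_div, mul_div_assoc]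
    exact mul_le_mul h3 h2 (by positivity) hB0

/-- The function that passes smoothly from `P j` to `P (j + 1)` between the points `t j` and
`t (j + 1)`, for `j < N`. -/
noncomputable def gluedPoly (N : ℕ) (t : ℕ → ℝ) (P : ℕ → ℝ[X]) (x : ℝ) : ℝ :=
  (P 0).eval x + ∑ j ∈ Finset.range N, switchedPoly (t j) (t (j + 1)) (P (j + 1) - P j) x

theorem contDiff_gluedPoly (N : ℕ) (t : ℕ → ℝ) (P : ℕ → ℝ[X]) :
    ContDiff ℝ ∞ (gluedPoly N t P) :=
  (contDiff_polynomial_eval _).add (ContDiff.sum fun _ _ => contDiff_switchedPoly _ _ _)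

/-- Near `t k` the increments with `j < k` are fully switched on and the others are off, so the sum
telescopes to `P k`. -/
theorem gluedPoly_eventuallyEq {N : ℕ} {t : ℕ → ℝ} (ht : StrictMonoOn t (Set.Iic N))
    (P : ℕ → ℝ[X]) {k : ℕ} (hk : k ≤ N) :
    gluedPoly N t P =ᶠ[nhds (t k)] fun x => (P k).eval x := by
  have h : ∀ j ∈ Finset.range N, switchedPoly (t j) (t (j + 1)) (P (j + 1) - P j) =ᶠ[nhds (t k)]
      fun x => if j < k then (P (j + 1)).eval x - (P j).eval x else 0 := by
    intro j hj
    have hj : j < N := by simpa using hj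
    have hlt : t j < t (j + 1) := ht (Set.mem_Iic.2 hj.le) (Set.mem_Iic.2 hj) (by omega)
    by_cases hjk : j < k
    · have := switchedPoly_eventuallyEq_eval hlt
        (ht.monotoneOn (Set.mem_Iic.2 hj) (Set.mem_Iic.2 hk) hjk) (P (j + 1) - P j)
      simpa [hjk] using this
    · have := switchedPoly_eventuallyEq_zero hlt
        (ht.monotoneOn (Set.mem_Iic.2 hk) (Set.mem_Iic.2 hj.le) (not_lt.1 hjk)) (P (j + 1) - P j)
      simpa [hjk] using this
  filter_upwards [(Filter.eventually_all_finset _).2 h] with x hx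
  rw [gluedPoly, Finset.sum_congr rfl hx, ← Finset.sum_filter,
    show (Finset.range N).filter (· < k) = Finset.range k by ext j; simp; omega,
    Finset.sum_range_sub (fun j => (P j).eval x)]
  ring

theorem taylorPoly_gluedPoly {n N : ℕ} {t : ℕ → ℝ} (ht : StrictMonoOn t (Set.Iic N))
    {P : ℕ → ℝ[X]} {k : ℕ} (hk : k ≤ N) (hP : (P k).natDegree ≤ n) :
    taylorPoly n (gluedPoly N t P) (t k) = P k := by
  refine taylorPoly_eq_of_forall hP fun i _ => ?_
  rw [(gluedPoly_eventuallyEq ht P hk).iteratedDeriv_eq, iteratedDeriv_polynomial_eval]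

theorem iteratedDeriv_gluedPoly {n N : ℕ} (t : ℕ → ℝ) {P : ℕ → ℝ[X]}
    (hP : ∀ k, (P k).natDegree ≤ n) (x : ℝ) :
    iteratedDeriv (n + 1) (gluedPoly N t P) x = ∑ j ∈ Finset.range N,
      iteratedDeriv (n + 1) (switchedPoly (t j) (t (j + 1)) (P (j + 1) - P j)) x := by
  have hs : ∀ j, ContDiff ℝ (n + 1 : ℕ) (switchedPoly (t j) (t (j + 1)) (P (j + 1) - P j)) :=
    fun j => (contDiff_switchedPoly _ _ _).of_le (by exact_mod_cast le_top)
  have h : gluedPoly N t P = fun x => (P 0).eval x +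
      ∑ j ∈ Finset.range N, switchedPoly (t j) (t (j + 1)) (P (j + 1) - P j) x := rfl
  rw [h, iteratedDeriv_fun_add (contDiff_polynomial_eval _).contDiffAt
    (ContDiff.sum fun j _ => hs j).contDiffAt, iteratedDeriv_fun_sum fun j _ => (hs j).contDiffAt,
    iteratedDeriv_polynomial_eval, iterate_derivative_eq_zero (by have := hP 0; omega)]
  simp

theorem natDegree_sub_succ_le {n : ℕ} {P : ℕ → ℝ[X]} (hP : ∀ k, (P k).natDegree ≤ n) (j : ℕ) :
    (P (j + 1) - P j).natDegree ≤ n :=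
  (natDegree_sub_le _ _).trans (max_le (hP _) (hP _))

theorem hasCompactSupport_iteratedDeriv_gluedPoly {n N : ℕ} {t : ℕ → ℝ}
    (ht : StrictMonoOn t (Set.Iic N)) {P : ℕ → ℝ[X]} (hP : ∀ k, (P k).natDegree ≤ n) :
    HasCompactSupport (iteratedDeriv (n + 1) (gluedPoly N t P)) := by
  refine HasCompactSupport.intro (isCompact_Icc (a := t 0) (b := t N)) fun x hx => ?_
  rw [iteratedDeriv_gluedPoly t hP]
  refine Finset.sum_eq_zero fun j hj => ?_
  have hj : j < N := by simpa using hj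
  refine iteratedDeriv_switchedPoly_eq_zero
    (ht (Set.mem_Iic.2 hj.le) (Set.mem_Iic.2 hj) (by omega)) (fun h => hx ⟨?_, ?_⟩)
    (natDegree_sub_succ_le hP j)
  · exact (ht.monotoneOn (Set.mem_Iic.2 (Nat.zero_le N)) (Set.mem_Iic.2 hj.le)
      (Nat.zero_le j)).trans h.1.le
  · exact h.2.le.trans (ht.monotoneOn (Set.mem_Iic.2 hj) (Set.mem_Iic.2 le_rfl) hj)

/-- The factor `h` is the length of the gap being integrated over. The power mean constant `(n + 1)
^ (p - 1)` is relaxed to `(n + 1) ^ p`, whose `p`-th root is free of `p`. -/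
theorem rpow_sum_div_pow_mul_le {n : ℕ} {p : ℝ} (hp : 1 < p) {h : ℝ} (hh : 0 < h) (r : ℕ → ℝ) :
    (∑ i ∈ Finset.range (n + 1), |r i| / h ^ (n + 1 - i)) ^ p * h ≤
      (n + 1 : ℝ) ^ p * ∑ i ∈ Finset.range (n + 1),
        |r i| ^ p / h ^ ((((n + 1 : ℕ) : ℝ) - i) * p - 1) := by
  have h1 := Real.rpow_sum_le_const_mul_sum_rpow_of_nonneg (Finset.range (n + 1))
    (f := fun i => |r i| / h ^ (n + 1 - i)) hp.le (fun _ _ => by positivity)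
  rw [Finset.card_range] at h1
  have h2 : ∀ i ∈ Finset.range (n + 1), (|r i| / h ^ (n + 1 - i)) ^ p * h =
      |r i| ^ p / h ^ ((((n + 1 : ℕ) : ℝ) - i) * p - 1) := by
    intro i hi
    have hi : i ≤ n + 1 := by have : i < n + 1 := by simpa using hi
                              omega
    rw [Real.div_rpow (by positivity) (by positivity), ← Real.rpow_natCast, ← Real.rpow_mul hh.le,
      Real.rpow_sub hh, Real.rpow_one, Nat.cast_sub hi]
    field_simp
  calc _ ≤ (((n + 1 : ℕ) : ℝ) ^ (p - 1) *
        ∑ i ∈ Finset.range (n + 1), (|r i| / h ^ (n + 1 - i)) ^ p) * h :=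
        mul_le_mul_of_nonneg_right h1 hh.le
    _ = ((n + 1 : ℕ) : ℝ) ^ (p - 1) * ∑ i ∈ Finset.range (n + 1),
        |r i| ^ p / h ^ ((((n + 1 : ℕ) : ℝ) - i) * p - 1) := by
        rw [mul_assoc, Finset.sum_mul, Finset.sum_congr rfl h2]
    _ ≤ _ := by
        refine mul_le_mul_of_nonneg_right ?_ (by positivity)
        push_cast
        exact Real.rpow_le_rpow_of_exponent_le (by linarith [n.cast_nonneg (α := ℝ)]) (by linarith)

/-- The estimate of the `L_p` norm of the derivative of order `n + 1` of `gluedPoly`, with a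
constant that depends on `n` only. -/
theorem exists_integral_iteratedDeriv_gluedPoly_le (n : ℕ) :
    ∃ B : ℝ, 0 ≤ B ∧ ∀ {p : ℝ}, 1 < p → ∀ {N : ℕ} {t : ℕ → ℝ}, StrictMonoOn t (Set.Iic N) →
      ∀ {P : ℕ → ℝ[X]}, (∀ k, (P k).natDegree ≤ n) →
      ∫ x, |iteratedDeriv (n + 1) (gluedPoly N t P) x| ^ p ≤
        B ^ p * ∑ j ∈ Finset.range N, ∑ i ∈ Finset.range (n + 1),
          |(derivative^[i] (P (j + 1) - P j)).eval (t j)| ^ p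
            / (t (j + 1) - t j) ^ ((((n + 1 : ℕ) : ℝ) - i) * p - 1) := by
  obtain ⟨B, hB0, hB⟩ := exists_abs_iteratedDeriv_switchedPoly_le n
  refine ⟨B * (n + 1), by positivity, fun {p} hp {N t} ht {P} hP => ?_⟩
  have hp0 : 0 < p := by linarith
  have hlt : ∀ j < N, t j < t (j + 1) := fun j hj =>
    ht (Set.mem_Iic.2 hj.le) (Set.mem_Iic.2 hj) (by omega)
  have hcont : Continuous (iteratedDeriv (n + 1) (gluedPoly N t P)) :=
    (contDiff_gluedPoly N t P).continuous_iteratedDeriv (n + 1) (by exact_mod_cast le_top)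
  set S : ℕ → ℝ := fun j => B * ∑ i ∈ Finset.range (n + 1),
    |(derivative^[i] (P (j + 1) - P j)).eval (t j)| / (t (j + 1) - t j) ^ (n + 1 - i) with hS
  have hS0 : ∀ j < N, 0 ≤ S j := fun j hj => by
    have := sub_pos.2 (hlt j hj)
    simp only [hS]
    positivity
  -- The open gaps are disjoint, so at most one summand is nonzero at `x` and the `p`-th power costs
  -- nothing.
  have hpt : ∀ x, |iteratedDeriv (n + 1) (gluedPoly N t P) x| ^ p ≤
      ∑ j ∈ Finset.range N, (Set.Ioo (t j) (t (j + 1))).indicator (fun _ => S j ^ p) x := by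
    intro x
    have hnn : ∀ j ∈ Finset.range N,
        0 ≤ (Set.Ioo (t j) (t (j + 1))).indicator (fun _ => S j ^ p) x := fun j hj =>
      Set.indicator_nonneg (fun _ _ => Real.rpow_nonneg (hS0 j (Finset.mem_range.1 hj)) _) _
    rw [iteratedDeriv_gluedPoly t hP]
    by_cases hx : ∃ j < N, x ∈ Set.Ioo (t j) (t (j + 1))
    · obtain ⟨j, hj, hxj⟩ := hx
      rw [Finset.sum_eq_single_of_mem j (Finset.mem_range.2 hj)]
      · refine le_trans ?_ (Finset.single_le_sum hnn (Finset.mem_range.2 hj))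
        rw [Set.indicator_of_mem hxj]
        exact Real.rpow_le_rpow (abs_nonneg _)
          (hB (hlt j hj) (natDegree_sub_succ_le hP j) (Set.Ioo_subset_Icc_self hxj)) hp0.le
      · intro k hk hkj
        have hk : k < N := by simpa using hk
        refine iteratedDeriv_switchedPoly_eq_zero (hlt k hk) (fun hxk => hkj ?_)
          (natDegree_sub_succ_le hP k)
        by_contra hne
        rcases lt_or_gt_of_ne hne with h | h
        · have := ht.monotoneOn (Set.mem_Iic.2 hk) (Set.mem_Iic.2 hj.le) h
          linarith [hxk.2, hxj.1]
        · have := ht.monotoneOn (Set.mem_Iic.2 hj) (Set.mem_Iic.2 hk.le) h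
          linarith [hxk.1, hxj.2]
    · push Not at hx
      rw [Finset.sum_eq_zero fun j hj => iteratedDeriv_switchedPoly_eq_zero
        (hlt j (Finset.mem_range.1 hj)) (hx j (Finset.mem_range.1 hj)) (natDegree_sub_succ_le hP j),
        abs_zero, Real.zero_rpow hp0.ne']
      exact Finset.sum_nonneg hnn
  have hint : ∀ j, Integrable ((Set.Ioo (t j) (t (j + 1))).indicator fun _ => S j ^ p) := fun j =>
    (integrable_indicator_iff measurableSet_Ioo).2 (integrableOn_const (by simp))
  have hmem : MemLp (iteratedDeriv (n + 1) (gluedPoly N t P)) (ENNReal.ofReal p) :=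
    hcont.memLp_of_hasCompactSupport (hasCompactSupport_iteratedDeriv_gluedPoly ht hP)
  refine (integral_mono (hmem.integrable_abs_rpow hp)
    (integrable_finsetSum _ fun j _ => hint j) hpt).trans ?_
  rw [integral_finsetSum _ fun j _ => hint j, Finset.mul_sum]
  refine Finset.sum_le_sum fun j hj => ?_
  have hj : j < N := by simpa using hj
  have hh := sub_pos.2 (hlt j hj)
  rw [integral_indicator measurableSet_Ioo, setIntegral_const, smul_eq_mul,
    Real.volume_real_Ioo_of_le (hlt j hj).le, mul_comm]
  simp only [hS]
  rw [Real.mul_rpow hB0 (by positivity), Real.mul_rpow hB0 (by positivity), mul_assoc, mul_assoc]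
  exact mul_le_mul_of_nonneg_left (rpow_sum_div_pow_mul_le hp hh _) (by positivity)

/-! ### Riesz's theorem: bounded `p`-variation gives an `L_p` derivative. -/

/-- Hölder for sums after multiplying and dividing by `l i ^ ((p - 1) / p)`. Degenerate intervals,
where the quotient is `0` by convention, are harmless because of `hd`. -/
theorem sum_abs_le_of_sum_rpow_div_le {ι : Type*} {p κ : ℝ} (hp : 1 < p) (s : Finset ι)
    {d l : ι → ℝ} (hl : ∀ i ∈ s, 0 ≤ l i) (hd : ∀ i ∈ s, l i = 0 → d i = 0)
    (h : ∑ i ∈ s, |d i| ^ p / l i ^ (p - 1) ≤ κ) :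
    ∑ i ∈ s, |d i| ≤ κ ^ (1 / p) * (∑ i ∈ s, l i) ^ ((p - 1) / p) := by
  have hp0 : 0 < p := by linarith
  have hp1 : 0 < p - 1 := by linarith
  have hq : p.HolderConjugate (p / (p - 1)) := Real.HolderConjugate.conjExponent hp
  have h1 := Real.inner_le_Lp_mul_Lq_of_nonneg s hq
    (f := fun i => |d i| / l i ^ ((p - 1) / p)) (g := fun i => l i ^ ((p - 1) / p))
    (fun i hi => div_nonneg (abs_nonneg _) (Real.rpow_nonneg (hl i hi) _))
    (fun i hi => Real.rpow_nonneg (hl i hi) _)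
  have e1 : ∑ i ∈ s, |d i| / l i ^ ((p - 1) / p) * l i ^ ((p - 1) / p) = ∑ i ∈ s, |d i| := by
    refine Finset.sum_congr rfl fun i hi => ?_
    rcases (hl i hi).eq_or_lt with h0 | h0
    · simp [hd i hi h0.symm]
    · have := Real.rpow_pos_of_pos h0 ((p - 1) / p)
      field_simp
  have e2 : ∑ i ∈ s, (|d i| / l i ^ ((p - 1) / p)) ^ p = ∑ i ∈ s, |d i| ^ p / l i ^ (p - 1) := by
    refine Finset.sum_congr rfl fun i hi => ?_
    rw [Real.div_rpow (abs_nonneg _) (Real.rpow_nonneg (hl i hi) _), ← Real.rpow_mul (hl i hi),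
      div_mul_cancel₀ _ hp0.ne']
  have e3 : ∑ i ∈ s, (l i ^ ((p - 1) / p)) ^ (p / (p - 1)) = ∑ i ∈ s, l i := by
    refine Finset.sum_congr rfl fun i hi => ?_
    rw [← Real.rpow_mul (hl i hi), div_mul_div_cancel₀ hp0.ne', div_self hp1.ne', Real.rpow_one]
  rw [e1, e2, e3, one_div_div] at h1
  refine h1.trans (mul_le_mul_of_nonneg_right (Real.rpow_le_rpow ?_ h (by positivity))
    (Real.rpow_nonneg (Finset.sum_nonneg hl) _))
  exact Finset.sum_nonneg fun i hi => div_nonneg (by positivity) (Real.rpow_nonneg (hl i hi) _)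

/-- A function whose `p`-variation in the sense of Riesz is bounded is absolutely continuous. -/
theorem isAbsolutelyContinuous_of_sum_le {G : ℝ → ℝ} {p κ : ℝ} (hp : 1 < p)
    (hJ : ∀ (ι : Type) (s : Finset ι) (a b : ι → ℝ),
      ((s : Set ι).PairwiseDisjoint fun i => Set.uIoc (a i) (b i)) →
      ∑ i ∈ s, |G (b i) - G (a i)| ^ p / |b i - a i| ^ (p - 1) ≤ κ) :
    IsAbsolutelyContinuous G := by
  intro a b
  have hp0 : 0 < (p - 1) / p := div_pos (by linarith) (by linarith)
  -- The exponent `(p - 1) / p` is positive, so the bound tends to zero with the total length.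
  have hlim : Filter.Tendsto (fun I : ℕ × (ℕ → ℝ × ℝ) => κ ^ (1 / p) *
      (∑ i ∈ Finset.range I.1, dist (I.2 i).1 (I.2 i).2) ^ ((p - 1) / p))
      (AbsolutelyContinuousOnInterval.totalLengthFilter ⊓
        Filter.principal (AbsolutelyContinuousOnInterval.disjWithin a b)) (nhds 0) := by
    have h1 : Filter.Tendsto (fun r : ℝ => κ ^ (1 / p) * r ^ ((p - 1) / p)) (nhds 0) (nhds 0) := by
      have := ((Real.continuous_rpow_const hp0.le).const_mul (κ ^ (1 / p))).tendsto 0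
      rwa [Real.zero_rpow hp0.ne', mul_zero] at this
    exact (h1.comp Filter.tendsto_comap).mono_left inf_le_left
  refine squeeze_zero' (Filter.Eventually.of_forall fun I => by positivity) ?_ hlim
  refine Filter.Eventually.filter_mono inf_le_right (Filter.eventually_principal.2 fun I hI => ?_)
  have := sum_abs_le_of_sum_rpow_div_le hp (Finset.range I.1)
    (d := fun i => G (I.2 i).2 - G (I.2 i).1) (l := fun i => |(I.2 i).2 - (I.2 i).1|)
    (fun _ _ => abs_nonneg _)
    (fun i _ h => by rw [abs_eq_zero, sub_eq_zero] at h; rw [h, sub_self]) (hJ ℕ _ _ _ hI.2)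
  simpa only [dist_comm _ (I.2 _).2, dist_comm _ (G (I.2 _).2), Real.dist_eq] using this

/-- Fold the line onto one period `(0, h]`. Over each orbit `x + hℤ` the integrand sums to a Riesz
sum on disjoint intervals divided by `h`, hence to at most `κ / h`; integrating over the period
restores `κ`. -/
theorem lintegral_difference_quotient_le {G : ℝ → ℝ} {p κ : ℝ} (hp : 1 < p) (hc : Continuous G)
    (hJ : ∀ (ι : Type) (s : Finset ι) (a b : ι → ℝ),
      ((s : Set ι).PairwiseDisjoint fun i => Set.uIoc (a i) (b i)) →
      ∑ i ∈ s, |G (b i) - G (a i)| ^ p / |b i - a i| ^ (p - 1) ≤ κ) {h : ℝ} (hh : 0 < h) :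
    ∫⁻ x, ENNReal.ofReal (|(G (x + h) - G x) / h| ^ p) ≤ ENNReal.ofReal κ := by
  have hp0 : 0 < p := by linarith
  have hφ : Continuous fun x => ENNReal.ofReal (|(G (x + h) - G x) / h| ^ p) := by
    refine ENNReal.continuous_ofReal.comp ?_
    refine Continuous.rpow_const ?_ fun _ => Or.inr hp0.le
    exact (((hc.comp (continuous_id.add continuous_const)).sub hc).div_const h).abs
  rw [(isAddFundamentalDomain_Ioc hh 0 volume).lintegral_eq_tsum'', ← lintegral_tsum]
  swap
  · intro z
    exact (hφ.measurable.comp (measurable_const_vadd z)).aemeasurable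
  have hbound : ∀ x, ∑' z : AddSubgroup.zmultiples h,
      ENNReal.ofReal (|(G ((z +ᵥ x) + h) - G (z +ᵥ x)) / h| ^ p) ≤ ENNReal.ofReal (κ / h) := by
    intro x
    rw [ENNReal.tsum_eq_iSup_sum]
    refine iSup_le fun s => ?_
    rw [← ENNReal.ofReal_sum_of_nonneg fun _ _ => by positivity]
    refine ENNReal.ofReal_le_ofReal ?_
    rw [le_div_iff₀ hh, Finset.sum_mul]
    refine le_trans (le_of_eq ?_) (hJ _ s (fun z => z +ᵥ x) (fun z => (z +ᵥ x) + h) ?_)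
    · refine Finset.sum_congr rfl fun z _ => ?_
      rw [add_sub_cancel_left, abs_div, Real.div_rpow (abs_nonneg _) (abs_nonneg _),
        abs_of_pos hh, Real.rpow_sub hh, Real.rpow_one]
      field_simp
    · intro z _ w _ hzw
      obtain ⟨k, hk⟩ := AddSubgroup.mem_zmultiples_iff.1 z.2
      obtain ⟨l, hl⟩ := AddSubgroup.mem_zmultiples_iff.1 w.2
      have hkl : k ≠ l := fun e => hzw (Subtype.ext (by rw [← hk, ← hl, e]))
      have := Set.pairwise_disjoint_Ioc_add_zsmul x h hkl
      simp only [Function.onFun, add_zsmul, one_zsmul, hk, hl] at this ⊢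
      rw [Set.uIoc_of_le (by linarith), Set.uIoc_of_le (by linarith)]
      simpa only [AddSubgroup.vadd_def, vadd_eq_add, add_comm, add_left_comm, add_assoc] using this
  refine (lintegral_mono hbound).trans_eq ?_
  rw [setLIntegral_const, zero_add, Real.volume_Ioc, sub_zero, ← ENNReal.ofReal_mul' hh.le,
    div_mul_cancel₀ _ hh.ne']

/-- Fatou's lemma along the steps `1 / (k + 1)`: the difference quotients converge almost everywhere
because `G` is absolutely continuous. -/
theorem lintegral_rpow_deriv_le_of_sum_le {G : ℝ → ℝ} {p κ : ℝ} (hp : 1 < p)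
    (hJ : ∀ (ι : Type) (s : Finset ι) (a b : ι → ℝ),
      ((s : Set ι).PairwiseDisjoint fun i => Set.uIoc (a i) (b i)) →
      ∑ i ∈ s, |G (b i) - G (a i)| ^ p / |b i - a i| ^ (p - 1) ≤ κ) :
    ∫⁻ x, ENNReal.ofReal (|deriv G x| ^ p) ≤ ENNReal.ofReal κ := by
  have hp0 : 0 < p := by linarith
  have hG := isAbsolutelyContinuous_of_sum_le hp hJ
  have hc := hG.continuous
  set h : ℕ → ℝ := fun k => 1 / ((k : ℝ) + 1)
  have hh : ∀ k, 0 < h k := fun k => Nat.one_div_pos_of_nat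
  have hlim : Filter.Tendsto h Filter.atTop (nhdsWithin 0 {0}ᶜ) :=
    tendsto_nhdsWithin_iff.2 ⟨tendsto_one_div_add_atTop_nhds_zero_nat,
      Filter.Eventually.of_forall fun k => (hh k).ne'⟩
  set φ : ℕ → ℝ → ℝ≥0∞ := fun k x => ENNReal.ofReal (|(G (x + h k) - G x) / h k| ^ p)
  have hφ : ∀ k, Measurable (φ k) := fun k => by
    refine (ENNReal.continuous_ofReal.comp ?_).measurable
    refine Continuous.rpow_const ?_ fun _ => Or.inr hp0.le
    exact (((hc.comp (continuous_id.add continuous_const)).sub hc).div_const _).abs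
  have hae : (fun x => ENNReal.ofReal (|deriv G x| ^ p)) =ᵐ[volume]
      fun x => Filter.liminf (fun k => φ k x) Filter.atTop := by
    filter_upwards [hG.ae_differentiableAt] with x hx
    have h1 := (hasDerivAt_iff_tendsto_slope_zero.1 hx.hasDerivAt).comp hlim
    refine (Filter.Tendsto.liminf_eq ?_).symm
    refine ENNReal.tendsto_ofReal ?_
    have h2 := (h1.abs).rpow_const (p := p) (Or.inr hp0.le)
    refine h2.congr fun k => ?_
    simp [div_eq_inv_mul]
  rw [lintegral_congr_ae hae]
  refine (lintegral_liminf_le hφ).trans ?_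
  refine (Filter.liminf_le_liminf (v := fun _ => ENNReal.ofReal κ)
    (Filter.Eventually.of_forall fun k => lintegral_difference_quotient_le hp hc hJ (hh k))).trans ?_
  simp

/-! ### Compactness: from finite subsets to the whole set. -/

/-- A single ultrafilter serves all points and all orders of derivative at once, so no subsequences
need to be extracted. -/
theorem exists_tendsto_ultrafilter_of_eventually_abs_sub_le {α : Type*} (U : Ultrafilter α)
    {u : α → ℝ} {c r : ℝ} (h : ∀ᶠ s in (U : Filter α), |u s - c| ≤ r) :
    ∃ l, Filter.Tendsto u U (nhds l) := by
  obtain ⟨l, -, hl⟩ := isCompact_iff_ultrafilter_le_nhds.1 (isCompact_closedBall c r) (U.map u)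
    (Filter.le_principal_iff.2 h)
  exact ⟨l, hl⟩

theorem hasDerivAt_sum_pow_div_factorial (c : ℕ → ℝ) (k : ℕ) (y : ℝ) :
    HasDerivAt (fun x => ∑ l ∈ Finset.range (k + 2), c l * (x - y) ^ l / l.factorial) (c 1) y := by
  have h : HasDerivAt (fun x => ∑ l ∈ Finset.range (k + 2), c l * (x - y) ^ l / l.factorial)
      (∑ l ∈ Finset.range (k + 2), c l * (l * (y - y) ^ (l - 1) * 1) / l.factorial) y :=
    HasDerivAt.fun_sum fun l _ =>
      ((((hasDerivAt_id y).sub_const y).pow l).const_mul (c l)).div_const _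
  convert h using 1
  rw [Finset.sum_range_succ', Finset.sum_range_succ']
  simp

theorem hasDerivAt_zero_of_abs_le_rpow {r : ℝ → ℝ} {y K β : ℝ} (hβ : 1 < β)
    (h : ∀ x, |r x| ≤ K * |x - y| ^ β) : HasDerivAt r 0 y := by
  have hy : r y = 0 := by
    have := h y
    rw [sub_self, abs_zero, Real.zero_rpow (by linarith), mul_zero] at this
    exact abs_eq_zero.1 (le_antisymm this (abs_nonneg _))
  rw [hasDerivAt_iff_tendsto]
  have hlim : Filter.Tendsto (fun x => K * |x - y| ^ (β - 1)) (nhds y) (nhds 0) := by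
    have hc : Continuous fun x => K * |x - y| ^ (β - 1) :=
      ((continuous_id.sub continuous_const).abs.rpow_const
        fun _ => Or.inr (by linarith)).const_mul K
    have := hc.tendsto y
    rwa [sub_self, abs_zero, Real.zero_rpow (by linarith), mul_zero] at this
  refine squeeze_zero (fun x => by positivity) (fun x => ?_) hlim
  rw [hy, smul_zero, sub_zero, sub_zero, Real.norm_eq_abs, Real.norm_eq_abs]
  rcases eq_or_ne x y with rfl | hxy
  · simp [Real.zero_rpow (show β - 1 ≠ 0 by linarith)]
  · have hpos : 0 < |x - y| := abs_pos.2 (sub_ne_zero.2 hxy)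
    rw [Real.rpow_sub hpos, Real.rpow_one, inv_mul_le_iff₀ hpos]
    refine (h x).trans_eq ?_
    field_simp

theorem abs_le_of_rpow_le {u A B e p : ℝ} (hp : 0 < p) (hA : 0 ≤ A) (hB : 0 ≤ B)
    (h : |u| ^ p ≤ A ^ e * B) : |u| ≤ B ^ p⁻¹ * A ^ (e / p) := by
  rw [← Real.le_rpow_inv_iff_of_pos (abs_nonneg _) (by positivity) hp,
    Real.mul_rpow (by positivity) hB, ← Real.rpow_mul hA, mul_comm] at h
  exact h

/-- A Whitney field whose restrictions to finite sets have extensions with uniformly bounded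
seminorms has an extension that satisfies the same bound. -/
theorem exists_extension_of_forall_finset {n : ℕ} {p κ : ℝ} (hp : 1 < p) (hκ0 : 0 ≤ κ)
    {E : Set ℝ} {P : E → ℝ[X]} (hP : IsWhitneyField n P) (x₀ : E) (F : Finset E → ℝ → ℝ)
    (hF : ∀ s, ContDiff ℝ n (F s)) (hG : ∀ s, IsAbsolutelyContinuous (iteratedDeriv n (F s)))
    (hg : ∀ s, MemLp (deriv (iteratedDeriv n (F s))) (ENNReal.ofReal p))
    (hκ : ∀ s, ∫ t, |deriv (iteratedDeriv n (F s)) t| ^ p ≤ κ)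
    (hT : ∀ s : Finset E, ∀ x ∈ s, taylorPoly n (F s) x = P x) :
    ∃ f : ℝ → ℝ, ContDiff ℝ n f ∧ IsAbsolutelyContinuous (iteratedDeriv n f) ∧
      ∫⁻ t, ENNReal.ofReal (|deriv (iteratedDeriv n f) t| ^ p) ≤ ENNReal.ofReal κ ∧
      ∀ x : E, taylorPoly n f x = P x := by
  classical
  have hp0 : 0 < p := by linarith
  -- Finer than `atTop`, so each point of `E` eventually belongs to the finite set.
  let U : Ultrafilter (Finset E) := Ultrafilter.of Filter.atTop
  have hU : (U : Filter (Finset E)) ≤ Filter.atTop := Ultrafilter.of_le _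
  have hmem : ∀ x : E, ∀ᶠ s in (U : Filter (Finset E)), x ∈ s := fun x =>
    ((Filter.eventually_ge_atTop {x}).filter_mono hU).mono fun s hs => hs (Finset.mem_singleton_self x)
  have hrem : ∀ s, ∀ i ≤ n, ∀ x y,
      |iteratedDeriv i (F s) x - (derivative^[i] (taylorPoly n (F s) y)).eval x| ^ p ≤
        |x - y| ^ ((((n + 1 : ℕ) : ℝ) - i) * p - 1) * κ := fun s i hi x y => by
    refine (rpow_abs_iteratedDeriv_sub_taylorPoly_le hp (hF s) (hG s) (hg s) hi x y).trans ?_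
    refine mul_le_mul_of_nonneg_left (le_trans ?_ (hκ s)) (by positivity)
    exact setIntegral_le_integral ((hg s).integrable_abs_rpow hp)
      (Filter.Eventually.of_forall fun _ => by positivity)
  have hex : ∀ i x, ∃ l, i ≤ n →
      Filter.Tendsto (fun s => iteratedDeriv i (F s) x) U (nhds l) := by
    intro i x
    by_cases hi : i ≤ n
    -- Once `x₀` lies in `s`, the Taylor polynomial of `F s` at `x₀` is the fixed `P x₀`, and the
    -- uniform remainder bound confines the values at `x` to a fixed ball.
    · obtain ⟨l, hl⟩ := exists_tendsto_ultrafilter_of_eventually_abs_sub_le U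
        (u := fun s => iteratedDeriv i (F s) x) (c := (derivative^[i] (P x₀)).eval x)
        (r := κ ^ p⁻¹ * |x - x₀| ^ (((((n + 1 : ℕ) : ℝ) - i) * p - 1) / p))
        ((hmem x₀).mono fun s hs => by
          have := hrem s i hi x x₀
          rw [hT s x₀ hs] at this
          exact abs_le_of_rpow_le hp0 (abs_nonneg _) hκ0 this)
      exact ⟨l, fun _ => hl⟩
    · exact ⟨0, fun h => absurd h hi⟩
  choose q hq using hex
  have hqE : ∀ i ≤ n, ∀ x : E, q i x = (derivative^[i] (P x)).eval (x : ℝ) := fun i hi x => by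
    refine tendsto_nhds_unique (hq i x hi) (tendsto_const_nhds.congr' ?_)
    filter_upwards [hmem x] with s hs
    rw [← hT s x hs, eval_iterate_derivative_taylorPoly hi]
  have hqrem : ∀ i ≤ n, ∀ x y, |q i x - ∑ l ∈ Finset.range (n + 1 - i),
      q (i + l) y * (x - y) ^ l / l.factorial| ^ p ≤
        |x - y| ^ ((((n + 1 : ℕ) : ℝ) - i) * p - 1) * κ := fun i hi x y => by
    refine le_of_tendsto' (x := (U : Filter (Finset E))) (f := fun s =>
      |iteratedDeriv i (F s) x - ∑ l ∈ Finset.range (n + 1 - i),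
        iteratedDeriv (i + l) (F s) y * (x - y) ^ l / l.factorial| ^ p) ?_ fun s => ?_
    · refine (((hq i x hi).sub (tendsto_finsetSum _ fun l hl => ?_)).abs).rpow_const
        (Or.inr hp0.le)
      have hl : i + l ≤ n := by have := Finset.mem_range.1 hl; omega
      exact ((hq (i + l) y hl).mul_const _).div_const _
    · have h1 := hrem s i hi x y
      have h2 : ∀ l ∈ Finset.range (n + 1 - i),
          (derivative^[i + l] (taylorPoly n (F s) y)).eval y * (x - y) ^ l / l.factorial =
            iteratedDeriv (i + l) (F s) y * (x - y) ^ l / l.factorial := fun l hl => by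
        have hl : i + l ≤ n := by have := Finset.mem_range.1 hl; omega
        rw [eval_iterate_derivative_taylorPoly hl]
      rwa [eval_iterate_derivative_eq_sum (natDegree_taylorPoly_le n (F s) y) hi x y,
        Finset.sum_congr rfl h2] at h1
  -- The remainder of `q i` is of order `|x - y| ^ β` with `β = n + 1 - i - 1 / p`, which exceeds
  -- `1` as `i < n` and `p > 1`. Hence the linear coefficient of the expansion is the derivative.
  have hqderiv : ∀ i < n, ∀ y, HasDerivAt (q i) (q (i + 1) y) y := fun i hi y => by
    obtain ⟨k, hk⟩ : ∃ k, n + 1 - i = k + 2 := ⟨n - 1 - i, by omega⟩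
    have h1 := hasDerivAt_sum_pow_div_factorial (fun l => q (i + l) y) k y
    have h2 : HasDerivAt (fun x => q i x - ∑ l ∈ Finset.range (k + 2),
        q (i + l) y * (x - y) ^ l / l.factorial) 0 y := by
      refine hasDerivAt_zero_of_abs_le_rpow
        (K := κ ^ p⁻¹) (β := ((((n + 1 : ℕ) : ℝ) - i) * p - 1) / p) ?_ fun x => ?_
      · rw [lt_div_iff₀ hp0]
        have : (i : ℝ) + 1 ≤ n := by exact_mod_cast hi
        push_cast
        nlinarith
      · have := hqrem i hi.le x y
        rw [hk] at this
        exact abs_le_of_rpow_le hp0 (abs_nonneg _) hκ0 this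
    have h3 := h2.add h1
    rw [zero_add] at h3
    refine h3.congr_of_eventuallyEq (Filter.Eventually.of_forall fun x => ?_)
    simp
  have hJ : ∀ (ι : Type) (s : Finset ι) (a b : ι → ℝ),
      ((s : Set ι).PairwiseDisjoint fun i => Set.uIoc (a i) (b i)) →
      ∑ i ∈ s, |q n (b i) - q n (a i)| ^ p / |b i - a i| ^ (p - 1) ≤ κ := by
    intro ι s a b hd
    refine le_of_tendsto' (x := (U : Filter (Finset E))) (f := fun r => ∑ i ∈ s,
      |iteratedDeriv n (F r) (b i) - iteratedDeriv n (F r) (a i)| ^ p / |b i - a i| ^ (p - 1))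
      ?_ fun r => (sum_rpow_abs_sub_div_le hp (hG r) (hg r) s a b hd).trans (hκ r)
    exact tendsto_finsetSum _ fun i _ => ((((hq n (b i) le_rfl).sub
      (hq n (a i) le_rfl)).abs).rpow_const (Or.inr hp0.le)).div_const _
  have hac := isAbsolutelyContinuous_of_sum_le hp hJ
  have hiter : ∀ i ≤ n, iteratedDeriv i (q 0) = q i := by
    intro i
    induction i with
    | zero => intro _; exact iteratedDeriv_zero
    | succ i ih =>
      intro hi
      rw [iteratedDeriv_succ, ih (by omega)]
      exact _root_.funext fun y => (hqderiv i hi y).deriv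
  refine ⟨q 0, ?_, ?_, ?_, fun x => ?_⟩
  · rw [contDiff_nat_iff_iteratedDeriv]
    constructor
    · intro i hi
      rw [hiter i hi]
      rcases hi.eq_or_lt with rfl | h
      · exact hac.continuous
      · exact continuous_iff_continuousAt.2 fun y => (hqderiv i h y).continuousAt
    · intro i hi
      rw [hiter i hi.le]
      exact fun y => (hqderiv i hi y).differentiableAt
  · rwa [hiter n le_rfl]
  · rw [hiter n le_rfl]
    exact lintegral_rpow_deriv_le_of_sum_le hp hJ
  · refine taylorPoly_eq_of_forall (hP x) fun i hi => ?_
    rw [hiter i hi, hqE i hi]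

/-! ### The two norm inequalities and the conclusion. -/

theorem eLpNorm_eq_lintegral_ofReal_abs_rpow {g : ℝ → ℝ} {p : ℝ} (hp : 1 < p) :
    eLpNorm g (ENNReal.ofReal p) = (∫⁻ t, ENNReal.ofReal (|g t| ^ p)) ^ (1 / p) := by
  have hp0 : 0 < p := by linarith
  rw [eLpNorm_eq_lintegral_rpow_enorm_toReal (by simpa using hp0) ENNReal.ofReal_ne_top,
    ENNReal.toReal_ofReal hp0.le]
  congr 1
  refine lintegral_congr fun t => ?_
  rw [← ENNReal.ofReal_rpow_of_nonneg (abs_nonneg _) hp0.le, ← Real.norm_eq_abs,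
    ofReal_norm]

theorem MemHomSobolev.isWeakDeriv_deriv {n : ℕ} {p : ℝ} {F : ℝ → ℝ}
    (hF : MemHomSobolev (n + 1) p F) : IsWeakDeriv (n + 1) F (deriv (iteratedDeriv n F)) :=
  isWeakDeriv_of_isAbsolutelyContinuous hF.contDiff hF.absolutelyContinuous

theorem MemHomSobolev.memLp_deriv {n : ℕ} {p : ℝ} {F : ℝ → ℝ} (hF : MemHomSobolev (n + 1) p F) :
    MemLp (deriv (iteratedDeriv n F)) (ENNReal.ofReal p) := by
  obtain ⟨g, hg, hgp⟩ := hF.exists_weakDeriv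
  exact (memLp_congr_ae (hg.ae_eq hF.isWeakDeriv_deriv)).1 hgp

theorem jetVariation_le_homSobolevSeminorm {n : ℕ} {p : ℝ} (hp : 1 < p) {F : ℝ → ℝ}
    (hF : MemHomSobolev (n + 1) p F) {E : Set ℝ} {P : E → ℝ[X]}
    (hP : ∀ x : E, taylorPoly n F x = P x) :
    jetVariation (n + 1) p P ≤ ((n + 1 : ℕ) : ℝ≥0∞) * homSobolevSeminorm (n + 1) p F := by
  have hp0 : 0 < p := by linarith
  have hg := hF.memLp_deriv
  rw [homSobolevSeminorm_eq hF.isWeakDeriv_deriv, eLpNorm_eq_lintegral_ofReal_abs_rpow hp]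
  set I := ∫⁻ t, ENNReal.ofReal (|deriv (iteratedDeriv n F) t| ^ p) with hI
  have hI' : ENNReal.ofReal (∫ t, |deriv (iteratedDeriv n F) t| ^ p) = I :=
    ofReal_integral_eq_lintegral_ofReal (hg.integrable_abs_rpow hp)
      (Filter.Eventually.of_forall fun _ => by positivity)
  have h : (⨆ (k : ℕ) (x : Fin (k + 2) → E) (_ : StrictMono x),
      ENNReal.ofReal (jetVariationSum (n + 1) p P x)) ≤ ((n + 1 : ℕ) : ℝ≥0∞) * I := by
    refine iSup_le fun k => iSup₂_le fun x hx => ?_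
    rw [← hI', ← ENNReal.ofReal_natCast, ← ENNReal.ofReal_mul (by positivity)]
    refine ENNReal.ofReal_le_ofReal ?_
    push_cast
    exact jetVariationSum_le hp hF.contDiff hF.absolutelyContinuous hg hP hx
  refine (ENNReal.rpow_le_rpow h (by positivity)).trans ?_
  rw [ENNReal.mul_rpow_of_nonneg _ _ (by positivity)]
  refine mul_le_mul_left ?_ _
  -- Since `n + 1 ≥ 1` and `1 / p ≤ 1`, the constant loses its dependence on `p`.
  refine (ENNReal.rpow_le_rpow_of_exponent_le (by simp) ((div_le_one hp0).2 hp.le)).trans_eq ?_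
  exact ENNReal.rpow_one _

theorem exists_extension_finset (n : ℕ) :
    ∃ B : ℝ, 0 ≤ B ∧ ∀ {p : ℝ}, 1 < p → ∀ {E : Set ℝ} {P : E → ℝ[X]}, IsWhitneyField n P →
      ∀ {v : ℝ}, 0 ≤ v → (∀ (k : ℕ) (x : Fin (k + 2) → E), StrictMono x →
        jetVariationSum (n + 1) p P x ≤ v) →
      ∀ s : Finset E, s.Nonempty → ∃ F : ℝ → ℝ, ContDiff ℝ n F ∧
        IsAbsolutelyContinuous (iteratedDeriv n F) ∧
        MemLp (deriv (iteratedDeriv n F)) (ENNReal.ofReal p) ∧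
        ∫ t, |deriv (iteratedDeriv n F) t| ^ p ≤ B ^ p * v ∧
        ∀ x ∈ s, taylorPoly n F (x : ℝ) = P x := by
  obtain ⟨B, hB0, hB⟩ := exists_integral_iteratedDeriv_gluedPoly_le n
  refine ⟨B, hB0, fun {p} hp {E P} hP {v} hv hsum s hs => ?_⟩
  obtain ⟨N, hN⟩ : ∃ N, s.card = N + 1 := ⟨s.card - 1, by have := hs.card_pos; omega⟩
  let e : Fin (N + 1) ↪o E := s.orderEmbOfFin hN
  -- The increasing enumeration of `s`, frozen after index `N` because `gluedPoly` takes sequences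
  -- on `ℕ`.
  let y : ℕ → E := fun j => e ⟨min j N, by omega⟩
  have hy : StrictMonoOn (fun j => (y j : ℝ)) (Set.Iic N) := fun i hi j hj hij => by
    have hi : i ≤ N := hi
    have hj : j ≤ N := hj
    refine e.strictMono (Fin.mk_lt_mk.2 ?_)
    omega
  have hPy : ∀ k, (P (y k)).natDegree ≤ n := fun k => hP (y k)
  have hsmooth := contDiff_gluedPoly N (fun j => (y j : ℝ)) fun j => P (y j)
  have hcont : Continuous (iteratedDeriv (n + 1)
      (gluedPoly N (fun j => (y j : ℝ)) fun j => P (y j))) :=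
    hsmooth.continuous_iteratedDeriv (n + 1) (by exact_mod_cast le_top)
  refine ⟨gluedPoly N (fun j => (y j : ℝ)) fun j => P (y j),
    hsmooth.of_le (by exact_mod_cast le_top), fun a b => ?_, ?_, ?_, fun x hx => ?_⟩
  · refine ContDiffOn.absolutelyContinuousOnInterval (ContDiff.contDiffOn ?_)
    rw [iteratedDeriv_eq_iterate]
    exact ContDiff.iterate_deriv' 1 n (hsmooth.of_le (by exact_mod_cast le_top))
  · rw [← iteratedDeriv_succ]
    exact hcont.memLp_of_hasCompactSupport (hasCompactSupport_iteratedDeriv_gluedPoly hy hPy)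
  · rw [← iteratedDeriv_succ]
    refine (hB hp hy hPy).trans (mul_le_mul_of_nonneg_left ?_ (by positivity))
    -- A single point has no gaps and an empty sum; otherwise the `N + 1 = k + 2` points form an
    -- admissible sequence.
    obtain _ | k := N
    · simpa using hv
    · refine le_trans (le_of_eq ?_) (hsum k e e.strictMono)
      rw [jetVariationSum, Finset.sum_range]
      refine Finset.sum_congr rfl fun j _ => Finset.sum_congr rfl fun i _ => ?_
      have h1 : y j = e j.castSucc := by
        refine congrArg e (Fin.ext ?_)
        simp only [Fin.val_castSucc]
        omega
      have h2 : y (j + 1) = e j.succ := by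
        refine congrArg e (Fin.ext ?_)
        simp only [Fin.val_succ]
        omega
      rw [h1, h2, iterate_derivative_sub, eval_sub, abs_sub_comm]
  · obtain ⟨j, rfl⟩ : ∃ j, e j = x := by
      have : x ∈ Set.range e := by rw [Finset.range_orderEmbOfFin]; exact hx
      exact this
    have h1 : y j = e j := congrArg e (Fin.ext (by simp only []; omega))
    rw [← h1]
    exact taylorPoly_gluedPoly (t := fun j => (y j : ℝ)) (P := fun j => P (y j)) hy
      (by omega) (hPy j)

theorem exists_memHomSobolev_extension (n : ℕ) :
    ∃ B : ℝ≥0, ∀ {p : ℝ}, 1 < p → ∀ {E : Set ℝ} {P : E → ℝ[X]}, IsWhitneyField n P →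
      jetVariation (n + 1) p P < ⊤ → ∃ F : ℝ → ℝ, MemHomSobolev (n + 1) p F ∧
        (∀ x : E, taylorPoly n F x = P x) ∧
        homSobolevSeminorm (n + 1) p F ≤ B * jetVariation (n + 1) p P := by
  obtain ⟨B, hB0, hB⟩ := exists_extension_finset n
  refine ⟨B.toNNReal, fun {p} hp {E P} hP hfin => ?_⟩
  have hp0 : 0 < p := by linarith
  set V := ⨆ (k : ℕ) (x : Fin (k + 2) → E) (_ : StrictMono x),
      ENNReal.ofReal (jetVariationSum (n + 1) p P x) with hV
  have hjV : jetVariation (n + 1) p P = V ^ (1 / p) := rfl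
  have hVtop : V ≠ ⊤ := fun h => by
    rw [hjV, h, ENNReal.top_rpow_of_pos (by positivity)] at hfin
    exact lt_irrefl _ hfin
  have hVle : ∀ (k : ℕ) (x : Fin (k + 2) → E), StrictMono x →
      jetVariationSum (n + 1) p P x ≤ V.toReal := fun k x hx => by
    refine (ENNReal.ofReal_le_iff_le_toReal hVtop).1 ?_
    exact le_iSup_of_le k (le_iSup₂_of_le x hx le_rfl)
  obtain ⟨f, hf, hfG, hfI, hfT⟩ : ∃ f : ℝ → ℝ, ContDiff ℝ n f ∧
      IsAbsolutelyContinuous (iteratedDeriv n f) ∧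
      ∫⁻ t, ENNReal.ofReal (|deriv (iteratedDeriv n f) t| ^ p) ≤ ENNReal.ofReal (B ^ p * V.toReal) ∧
      ∀ x : E, taylorPoly n f x = P x := by
    classical
    rcases isEmpty_or_nonempty E with hE | ⟨⟨x₀⟩⟩
    · have h0 : iteratedDeriv n (fun _ : ℝ => (0 : ℝ)) = fun _ => 0 := by
        ext x; simp
      refine ⟨fun _ => 0, contDiff_const, ?_, ?_, fun x => isEmptyElim x⟩
      · rw [h0]
        exact fun a b => contDiffOn_const.absolutelyContinuousOnInterval
      · rw [h0]
        simp [Real.zero_rpow hp0.ne']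
    -- Inserting `x₀` makes every finite set nonempty, as the gluing requires.
    · have hex := fun s : Finset E => hB hp hP ENNReal.toReal_nonneg hVle (insert x₀ s)
        (Finset.insert_nonempty _ _)
      choose F hF hG hg hκ hT using hex
      exact exists_extension_of_forall_finset hp (by positivity) hP x₀ F hF hG hg hκ
        fun s x hx => hT s x (Finset.mem_insert_of_mem hx)
  have hweak := isWeakDeriv_of_isAbsolutelyContinuous hf hfG
  have hnorm : eLpNorm (deriv (iteratedDeriv n f)) (ENNReal.ofReal p) ≤
      (B.toNNReal : ℝ≥0∞) * V ^ (1 / p) := by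
    rw [eLpNorm_eq_lintegral_ofReal_abs_rpow hp]
    refine (ENNReal.rpow_le_rpow hfI (by positivity)).trans_eq ?_
    rw [ENNReal.ofReal_mul (by positivity), ENNReal.ofReal_toReal hVtop,
      ENNReal.mul_rpow_of_nonneg _ _ (by positivity), ← ENNReal.ofReal_rpow_of_nonneg hB0 hp0.le,
      ← ENNReal.rpow_mul, mul_one_div_cancel hp0.ne', ENNReal.rpow_one]
    rfl
  refine ⟨f, ⟨hf, hfG, _, hweak, (measurable_deriv _).aestronglyMeasurable,
    hnorm.trans_lt (ENNReal.mul_lt_top ENNReal.coe_lt_top hfin)⟩, hfT, ?_⟩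
  rw [homSobolevSeminorm_eq hweak, hjV]
  exact hnorm

theorem theorem4p1 (m : ℕ) (hm : 1 ≤ m) :
    ∃ C : ℝ≥0, 1 ≤ C ∧
      ∀ (p : ℝ), 1 < p →
      ∀ (E : Set ℝ), IsClosed E →
      ∀ (P : E → ℝ[X]), IsWhitneyField (m - 1) P →
        ((∃ F : ℝ → ℝ, ContDiff ℝ (m - 1 : ℕ) F ∧ MemHomSobolev m p F ∧
            ∀ x : E, taylorPoly (m - 1) F x = P x) ↔ jetVariation m p P < ⊤) ∧
        jetNorm m p P ≤ (C : ℝ≥0∞) * jetVariation m p P ∧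
        jetVariation m p P ≤ (C : ℝ≥0∞) * jetNorm m p P := by
  obtain ⟨n, rfl⟩ : ∃ n, m = n + 1 := ⟨m - 1, by omega⟩
  rw [Nat.add_sub_cancel]
  obtain ⟨B, hB⟩ := exists_memHomSobolev_extension n
  have hC0 : 1 ≤ B + ((n + 1 : ℕ) : ℝ≥0) := by
    push_cast
    exact le_add_left (le_add_left le_rfl)
  refine ⟨B + ((n + 1 : ℕ) : ℝ≥0), hC0, fun p hp E _ P hP => ⟨⟨?_, ?_⟩, ?_, ?_⟩⟩
  · rintro ⟨F, -, hF, hFP⟩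
    refine (jetVariation_le_homSobolevSeminorm hp hF hFP).trans_lt
      (ENNReal.mul_lt_top (ENNReal.natCast_lt_top _) ?_)
    rw [homSobolevSeminorm_eq hF.isWeakDeriv_deriv]
    exact hF.memLp_deriv.2
  · intro h
    obtain ⟨F, hF, hFP, -⟩ := hB hp hP h
    exact ⟨F, hF.contDiff, hF, hFP⟩
  · rcases eq_or_ne (jetVariation (n + 1) p P) ⊤ with h | h
    -- With infinite variation the bound is trivial, because a nonzero constant times `⊤` is `⊤`.
    · rw [h, ENNReal.mul_top (by exact_mod_cast (zero_lt_one.trans_le hC0).ne')]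
      exact le_top
    · obtain ⟨F, hF, hFP, hle⟩ := hB hp hP (lt_top_iff_ne_top.2 h)
      refine (iInf₂_le F ⟨hF, hFP⟩).trans (hle.trans ?_)
      gcongr
      exact le_self_add
  · have hCne : ((B + ((n + 1 : ℕ) : ℝ≥0) : ℝ≥0) : ℝ≥0∞) ≠ 0 := by
      exact_mod_cast (zero_lt_one.trans_le hC0).ne'
    -- Dividing by the constant isolates the infimum, so each competitor `F` can be treated
    -- separately; an empty infimum is covered too.
    rw [mul_comm, ← ENNReal.div_le_iff_le_mul (Or.inl hCne) (Or.inl ENNReal.coe_ne_top)]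
    refine le_iInf₂ fun F hF => ?_
    rw [ENNReal.div_le_iff_le_mul (Or.inl hCne) (Or.inl ENNReal.coe_ne_top), mul_comm]
    refine (jetVariation_le_homSobolevSeminorm hp hF.1 hF.2).trans ?_
    gcongr
    push_cast
    exact le_add_self
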